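/- Theorem (Saturation Theorem). Let $A$ be a finite alphabet with an involution $\theta:A\to A$ (possibly with fixed points), and let $G_\theta$ be the group generated by $A$ with the relations $a\,\theta(a)=1$ for $a\in A$. The inverse of a word $w=a_1\cdots a_n$ is $w^{-1}=\theta(a_n)\cdots\theta(a_1)$; a set of words is symmetric if it is closed under taking inverses. A word is reduced if it has no factor $a\,\theta(a)$ with $a\in A$. Every element of $G_\theta$ is represented by a unique reduced word, and a reduced word is identified with the element that it represents. A set $S$ of words on $A$ is biextendable if it contains $A$ and all the factors of its elements, and if for every $w\in S$ there are $a,b\in A$ with $awb\in S$. It is laminary (relative to $\theta$) if it is biextendable, symmetric and consists of reduced words. A biextendable set $S$ is acyclic if for every $w\in S$ the following graph has no cycle: its vertex set is the disjoint union of $\{a\in A\mid aw\in S\}$ and $\{b\in A\mid wb\in S\}$, and its edges are the pairs $(a,b)\in A\times A$ such that $awb\in S$. A bifix code is a set of nonempty words that contains no proper prefix and no proper suffix of any of its elements. For a subgroup $H$ of $G_\theta$, the prime words in $S$ with respect to $H$ are the nonempty words of $H\cap S$ that have no proper nonempty prefix in $H\cap S$. Let $S$ be an acyclic laminary set, let $X\subset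 S$ be a finite symmetric bifix code, let $\langle X\rangle$ be the subgroup of $G_\theta$ generated by $X$, and let $X^*$ be the set of all concatenations $x_1\cdots x_n$ with $n\ge 0$ and $x_i\in X$. Then $X$ is the set of prime words in $S$ with respect to $\langle X\rangle$. Moreover $\langle X\rangle\cap S=X^*\cap S$. -/

import Mathlib

/-- Words over the alphabet `A` are lists. The formal inverse of the word `a₁ ⋯ aₙ` with respect to
`θ` is `θ(aₙ) ⋯ θ(a₁)`; it represents the inverse element in the group `SpecularGroup θ`. -/
def wordInv {A : Type*} (θ : A → A) (w : List A) : List A := (w.map θ).reverse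

/-- A set of words is symmetric if it is closed under taking inverses. -/
def IsSymmetricSet {A : Type*} (θ : A → A) (X : Set (List A)) : Prop :=
  ∀ w ∈ X, wordInv θ w ∈ X

/-- A word is `θ`-reduced if it has no factor `a θ(a)`. -/
def IsReducedWord {A : Type*} (θ : A → A) (w : List A) : Prop :=
  ∀ a : A, ¬ [a, θ a] <:+: w

/-- The group `G_θ` generated by `A` with the relations `a θ(a) = 1` for all `a` in `A`. -/
abbrev SpecularGroup {A : Type*} (θ : A → A) : Type _ :=
  PresentedGroup (Set.range fun a : A => FreeGroup.of a * FreeGroup.of (θ a))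

/-- The element of `G_θ` represented by a word. -/
def wordToGroup {A : Type*} (θ : A → A) (w : List A) : SpecularGroup θ :=
  (w.map fun a => (PresentedGroup.of a : SpecularGroup θ)).prod

/-- A set of words is factorial if it contains the alphabet and all the factors of its elements. -/
def IsFactorial {A : Type*} (S : Set (List A)) : Prop :=
  (∀ a : A, [a] ∈ S) ∧ ∀ u v : List A, v ∈ S → u <:+: v → u ∈ S

/-- A factorial set in which every word `w` has letters `a`, `b` such that `a w b` is in the set. -/
def IsBiextendable {A : Type*} (S : Set (List A)) : Prop :=
  IsFactorial S ∧ ∀ w ∈ S, ∃ a b : A, a :: (w ++ [b]) ∈ S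

/-- The left extensions `L(w)` of `w` in `S`. -/
def leftExt {A : Type*} (S : Set (List A)) (w : List A) : Set A := {a | a :: w ∈ S}

/-- The right extensions `R(w)` of `w` in `S`. -/
def rightExt {A : Type*} (S : Set (List A)) (w : List A) : Set A := {b | w ++ [b] ∈ S}

/-- The extension graph of `w`: its vertices are the disjoint union of `L(w)` and `R(w)`, its edges
are the pairs `(a, b)` such that `a w b` is in `S`. -/
def extensionGraph {A : Type*} (S : Set (List A)) (w : List A) :
    SimpleGraph (leftExt S w ⊕ rightExt S w) where
  Adj x y :=
    (∃ a b, x = Sum.inl a ∧ y = Sum.inr b ∧ a.1 :: (w ++ [b.1]) ∈ S) ∨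
    (∃ a b, y = Sum.inl a ∧ x = Sum.inr b ∧ a.1 :: (w ++ [b.1]) ∈ S)
  symm := ⟨fun _ _ h => h.symm⟩
  loopless := ⟨by
    rintro x (⟨a, b, h, h', -⟩ | ⟨a, b, h, h', -⟩) <;> simp [h] at h'⟩

/-- A biextendable set is acyclic if the extension graphs of all its words are acyclic. -/
def IsAcyclicSet {A : Type*} (S : Set (List A)) : Prop :=
  IsBiextendable S ∧ ∀ w ∈ S, (extensionGraph S w).IsAcyclic

/-- A laminary set relative to `θ`: a symmetric biextendable set of reduced words. -/
def IsLaminary {A : Type*} (θ : A → A) (S : Set (List A)) : Prop :=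
  IsSymmetricSet θ S ∧ IsBiextendable S ∧ ∀ w ∈ S, IsReducedWord θ w

/-- A set of nonempty words which contains no proper prefix of its elements. -/
def IsPrefixCode {A : Type*} (X : Set (List A)) : Prop :=
  (∀ x ∈ X, x ≠ []) ∧ ∀ x ∈ X, ∀ y ∈ X, x <+: y → x = y

/-- A set of nonempty words which contains no proper suffix of its elements. -/
def IsSuffixCode {A : Type*} (X : Set (List A)) : Prop :=
  (∀ x ∈ X, x ≠ []) ∧ ∀ x ∈ X, ∀ y ∈ X, x <:+ y → x = y

def IsBifixCode {A : Type*} (X : Set (List A)) : Prop :=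
  IsPrefixCode X ∧ IsSuffixCode X

/-- The submonoid `X*` of the free monoid on `A` generated by `X`: the concatenations of finite
sequences of words of `X`. -/
def wordStar {A : Type*} (X : Set (List A)) : Set (List A) :=
  {w | ∃ l : List (List A), (∀ x ∈ l, x ∈ X) ∧ l.flatten = w}

/-- The subgroup `⟨X⟩` of `G_θ` generated by the elements represented by the words of `X`. -/
def subgroupGenerated {A : Type*} (θ : A → A) (X : Set (List A)) : Subgroup (SpecularGroup θ) :=
  Subgroup.closure (wordToGroup θ '' X)

/-- The intersection `H ∩ S`: the words of `S` which represent an element of `H`. -/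
def interWords {A : Type*} (θ : A → A) (H : Subgroup (SpecularGroup θ)) (S : Set (List A)) :
    Set (List A) :=
  {w | w ∈ S ∧ wordToGroup θ w ∈ H}

/-- The prime words in `S` with respect to `H`: the nonempty words in `H ∩ S` without a proper
nonempty prefix in `H ∩ S`. -/
def primeWords {A : Type*} (θ : A → A) (H : Subgroup (SpecularGroup θ)) (S : Set (List A)) :
    Set (List A) :=
  {w | w ∈ interWords θ H S ∧ w ≠ [] ∧
    ∀ p : List A, p <+: w → p ≠ [] → p ≠ w → p ∉ interWords θ H S}

/-! Let H = ⟨X⟩. Words are grouped into states by the relation generated by `p ~ p'` when p p'⁻¹ ∈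
X; related words lie in the same coset Hp. The words of X give transitions by letters between
states. If these are deterministic (`CosetStep.rel`), then, as inverting X reverses transitions,
deleting a factor a θ(a) preserves paths. A product of words of X labels a loop at the empty word,
so its reduced form does too; reading that loop along a word of S cuts the word into elements of X
(`CosetPath.mem_wordStar`). Hence H ∩ S = X* ∩ S, and X is its set of prime words because it is a
prefix code.

Determinism comes from acyclicity. A downward induction on |w| shows that words connected on the
left of w and followed by the same letter b stay connected on the left of wb
(`leftDeterministic_of_longer`): by induction, the graph of components maps locally injectively to
the extension graph of w, a forest, so its paths are controlled by their letters. Chains of odd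
length in the state relation are excluded by the symmetry of the extension graph of the empty word
(`extGraph_nil_not_reachable`). -/

/-- The bipartite graph on `α ⊕ β` whose edges are the pairs related by `r`. -/
def relGraph {α β : Type*} (r : α → β → Prop) : SimpleGraph (α ⊕ β) where
  Adj x y := (∃ a b, x = Sum.inl a ∧ y = Sum.inr b ∧ r a b) ∨
    (∃ a b, y = Sum.inl a ∧ x = Sum.inr b ∧ r a b)
  symm := ⟨fun _ _ h => h.symm⟩
  loopless := ⟨by
    rintro x (⟨a, b, h, h', -⟩ | ⟨a, b, h, h', -⟩) <;> simp [h] at h'⟩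

section relGraph

variable {α β : Type*} {r : α → β → Prop}

@[simp]
theorem relGraph_adj_inl_inr {a : α} {b : β} :
    (relGraph r).Adj (Sum.inl a) (Sum.inr b) ↔ r a b := by
  simp [relGraph]

@[simp]
theorem relGraph_adj_inr_inl {a : α} {b : β} :
    (relGraph r).Adj (Sum.inr b) (Sum.inl a) ↔ r a b := by
  simp [relGraph]

@[simp]
theorem relGraph_not_adj_inl_inl {a a' : α} :
    ¬ (relGraph r).Adj (Sum.inl a) (Sum.inl a') := by
  simp [relGraph]

@[simp]
theorem relGraph_not_adj_inr_inr {b b' : β} :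
    ¬ (relGraph r).Adj (Sum.inr b) (Sum.inr b') := by
  simp [relGraph]

theorem relGraph_swap_isAcyclic (h : (relGraph r).IsAcyclic) :
    (relGraph fun b a => r a b).IsAcyclic := by
  refine h.comap ⟨Sum.swap, ?_⟩ Sum.swap_leftInverse.injective
  rintro (a | a) (b | b) <;> simp

end relGraph

/-! ### Locally injective maps to forests, and involutions of forests -/

namespace SimpleGraph

variable {V W : Type*} {G : SimpleGraph V} {H : SimpleGraph W}

/-- Acyclicity only depends on the subgraph induced on the non-isolated vertices. -/
theorem isAcyclic_of_induce_nonisolated (h : (G.induce {x | ∃ y, G.Adj x y}).IsAcyclic) :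
    G.IsAcyclic := by
  intro v c hc
  have hs : ∀ x ∈ c.support, x ∈ {x | ∃ y, G.Adj x y} := fun x hx => by
    obtain ⟨y, -, hy⟩ := adj_of_mem_walk_support c hc.not_nil hx
    exact ⟨y, hy⟩
  refine h (c.induce _ hs) ?_
  rw [← Walk.isCycle_map_iff_of_injective (f := (Embedding.induce (G := G) _).toHom)
    (Embedding.induce (G := G) _).injective]
  simpa using hc

/-- A locally injective homomorphism to an acyclic graph maps paths to paths. -/
theorem Walk.IsPath.map_of_locallyInjective (hH : H.IsAcyclic) (f : G →g H)
    (hf : ∀ x y z, G.Adj x y → G.Adj x z → f y = f z → y = z) {u v : V} {p : G.Walk u v}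
    (hp : p.IsPath) : (p.map f).IsPath := by
  rw [hH.isPath_iff_isChain, Walk.edges_map]
  induction p with
  | nil => simp
  | @cons x y z h q ih =>
    cases q with
    | nil => simp
    | @cons _ t _ h' q =>
      have hxt : x ≠ t := by
        rintro rfl
        simp [Walk.cons_isPath_iff] at hp
      have := ih hp.of_cons
      simp only [Walk.edges_cons, List.map_cons, List.isChain_cons_cons, Sym2.map_mk] at this ⊢
      refine ⟨?_, this⟩
      intro he
      rw [Sym2.eq_iff] at he
      rcases he with ⟨h1, -⟩ | ⟨h1, -⟩
      · exact (f.map_adj h).ne h1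
      · exact hxt (hf y x t h.symm h' h1)

/-- A nontrivial path would be mapped to a path, which cannot return to its starting vertex. -/
theorem Reachable.eq_of_locallyInjective (hH : H.IsAcyclic) (f : G →g H)
    (hf : ∀ x y z, G.Adj x y → G.Adj x z → f y = f z → y = z) {u v : V}
    (h : G.Reachable u v) (huv : f u = f v) : u = v := by
  obtain ⟨p, hp⟩ := h.exists_isPath
  have h1 := hp.map_of_locallyInjective hH f hf
  cases p with
  | nil => rfl
  | cons a q =>
    exfalso
    rw [Walk.map_cons, Walk.cons_isPath_iff] at h1
    refine h1.2 ?_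
    rw [huv]
    exact Walk.end_mem_support _

/-- A locally injective homomorphism to an acyclic graph reflects common neighbours of distinct
connected vertices. -/
theorem Reachable.exists_adj_adj_of_locallyInjective (hH : H.IsAcyclic) (f : G →g H)
    (hf : ∀ x y z, G.Adj x y → G.Adj x z → f y = f z → y = z) {u v : V} {b : W}
    (h : G.Reachable u v) (huv : f u ≠ f v) (hu : H.Adj (f u) b) (hv : H.Adj b (f v)) :
    ∃ s, f s = b ∧ G.Adj u s ∧ G.Adj s v := by
  obtain ⟨p, hp⟩ := h.exists_isPath
  have h1 := hp.map_of_locallyInjective hH f hf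
  have h2 : (Walk.cons hu (Walk.cons hv Walk.nil)).IsPath := by
    simp [Walk.cons_isPath_iff, huv, hu.ne, hv.ne]
  have h3 : p.map f = Walk.cons hu (Walk.cons hv Walk.nil) :=
    congrArg Subtype.val ((hH.subsingleton_path _ _).elim ⟨_, h1⟩ ⟨_, h2⟩)
  have h4 : p.length = 2 := by
    rw [← Walk.length_map f p, h3]; rfl
  cases p with
  | nil => simp at h4
  | @cons _ s _ hus q =>
    cases q with
    | nil => simp at h4
    | @cons _ t _ hst q =>
      cases q with
      | nil =>
        refine ⟨s, ?_, hus, hst⟩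
        have := congrArg Walk.support h3
        simpa using this
      | cons _ q => simp at h4

/-- In an acyclic graph, no vertex is connected with its image by an involution which exchanges
the ends of no edge and which fixes no vertex. -/
theorem IsAcyclic.not_reachable_involutive (hG : G.IsAcyclic) (σ : G →g G)
    (hσ : Function.Involutive σ) (hfix : ∀ x, σ x ≠ x) (hadj : ∀ x, ¬ G.Adj x (σ x)) (x : V) :
    ¬ G.Reachable x (σ x) := by
  intro h
  obtain ⟨p, hp⟩ := h.exists_isPath
  have hq : (((p.map σ).copy rfl (hσ x)).reverse).IsPath := by
    rw [Walk.isPath_reverse_iff, Walk.isPath_copy]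
    exact hp.map hσ.injective
  have hpq : p = ((p.map σ).copy rfl (hσ x)).reverse :=
    congrArg Subtype.val ((hG.subsingleton_path _ _).elim ⟨_, hp⟩ ⟨_, hq⟩)
  have hv : ∀ i, p.getVert i = σ (p.getVert (p.length - i)) := by
    intro i
    conv_lhs => rw [hpq]
    simp [Walk.getVert_reverse, Walk.getVert_copy, Walk.getVert_map]
  -- As σ reverses the path, it fixes the middle vertex if the length is even and flips the middle
  -- edge if it is odd.
  obtain ⟨k, hk⟩ | ⟨k, hk⟩ := Nat.even_or_odd p.length
  · have := hv k
    rw [hk, Nat.add_sub_cancel] at this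
    exact hfix _ this.symm
  · have h1 := hv (k + 1)
    have h2 : p.length - (k + 1) = k := by omega
    have h3 := p.adj_getVert_succ (i := k) (by omega)
    rw [h1, h2] at h3
    exact hadj _ h3

end SimpleGraph

/-! ### Connections around a word and their determinism -/

section Connections

variable {A : Type*}

/-- Two words `p`, `p'` are linked on the left of `w` if `p w q` and `p' w q` belong to `X` for some
word `q`. -/
def LeftStep (X : Set (List A)) (w p p' : List A) : Prop :=
  ∃ q, p ++ (w ++ q) ∈ X ∧ p' ++ (w ++ q) ∈ X

/-- Two words `q`, `q'` are linked on the right of `w` if `p w q` and `p w q'` belong to `X` for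
some word `p`. -/
def RightStep (X : Set (List A)) (w q q' : List A) : Prop :=
  ∃ p, p ++ (w ++ q) ∈ X ∧ p ++ (w ++ q') ∈ X

def LeftConn (X : Set (List A)) (w : List A) : List A → List A → Prop :=
  Relation.ReflTransGen (LeftStep X w)

def RightConn (X : Set (List A)) (w : List A) : List A → List A → Prop :=
  Relation.ReflTransGen (RightStep X w)

variable {X : Set (List A)} {S : Set (List A)}

theorem LeftStep.symm {w p p' : List A} (h : LeftStep X w p p') : LeftStep X w p' p :=
  let ⟨q, h1, h2⟩ := h
  ⟨q, h2, h1⟩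

theorem RightStep.symm {w q q' : List A} (h : RightStep X w q q') : RightStep X w q' q :=
  let ⟨p, h1, h2⟩ := h
  ⟨p, h2, h1⟩

theorem LeftConn.symm {w p p' : List A} (h : LeftConn X w p p') : LeftConn X w p' p :=
  haveI : Std.Symm (LeftStep X w) := ⟨fun _ _ h => h.symm⟩
  Relation.ReflTransGen.stdSymm.symm _ _ h

theorem RightConn.symm {w q q' : List A} (h : RightConn X w q q') : RightConn X w q' q :=
  haveI : Std.Symm (RightStep X w) := ⟨fun _ _ h => h.symm⟩
  Relation.ReflTransGen.stdSymm.symm _ _ h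

/-- Components are encoded as sets of words so that they can label vertices of `componentGraph`. -/
theorem setOf_leftConn_eq_iff {w p p' : List A} :
    {u | LeftConn X w p u} = {u | LeftConn X w p' u} ↔ LeftConn X w p p' := by
  constructor
  · intro h
    have : p' ∈ {u | LeftConn X w p' u} := Relation.ReflTransGen.refl
    rwa [← h] at this
  · intro h
    ext u
    exact ⟨h.symm.trans, h.trans⟩

theorem setOf_rightConn_eq_iff {w q q' : List A} :
    {u | RightConn X w q u} = {u | RightConn X w q' u} ↔ RightConn X w q q' := by
  constructor
  · intro h
    have : q' ∈ {u | RightConn X w q' u} := Relation.ReflTransGen.refl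
    rwa [← h] at this
  · intro h
    ext u
    exact ⟨h.symm.trans, h.trans⟩

/-- Words linked to the left of `a w` remain linked on the left of `w` after appending `a`. -/
theorem LeftConn.snoc {w u u' : List A} {a : A} (h : LeftConn X (a :: w) u u') :
    LeftConn X w (u ++ [a]) (u' ++ [a]) := by
  induction h with
  | refl => exact .refl
  | tail _ hs ih =>
    obtain ⟨q, h1, h2⟩ := hs
    exact ih.tail ⟨q, by simpa using h1, by simpa using h2⟩

/-- Words linked to the left of `w b` are linked on the left of `w`. -/
theorem LeftConn.of_snoc {w u u' : List A} {b : A} (h : LeftConn X (w ++ [b]) u u') :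
    LeftConn X w u u' := by
  induction h with
  | refl => exact .refl
  | tail _ hs ih =>
    obtain ⟨q, h1, h2⟩ := hs
    exact ih.tail ⟨b :: q, by simpa using h1, by simpa using h2⟩

/-- Words linked to the right of `a w` are linked on the right of `w`. -/
theorem RightConn.of_cons {w u u' : List A} {a : A} (h : RightConn X (a :: w) u u') :
    RightConn X w u u' := by
  induction h with
  | refl => exact .refl
  | tail _ hs ih =>
    obtain ⟨q, h1, h2⟩ := hs
    exact ih.tail ⟨q ++ [a], by simpa using h1, by simpa using h2⟩

/-- Words linked on the left of `w` to words which are linked on the right of `w`. -/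
theorem RightConn.leftConn {w u u' v v' : List A} (h : RightConn X w v v')
    (hu : u ++ (w ++ v) ∈ X) (hu' : u' ++ (w ++ v') ∈ X) : LeftConn X w u u' := by
  induction h generalizing u' with
  | refl => exact .single ⟨v, hu, hu'⟩
  | tail _ hs ih =>
    obtain ⟨p, h1, h2⟩ := hs
    exact (ih h1).tail ⟨_, h2, hu'⟩

theorem LeftConn.rightConn {w u u' v v' : List A} (h : LeftConn X w u u')
    (hu : u ++ (w ++ v) ∈ X) (hu' : u' ++ (w ++ v') ∈ X) : RightConn X w v v' := by
  induction h generalizing v' with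
  | refl => exact .single ⟨u, hu, hu'⟩
  | tail _ hs ih =>
    obtain ⟨p, h1, h2⟩ := hs
    exact (ih h1).tail ⟨_, h2, hu'⟩

theorem IsPrefixCode.eq_nil_of_append (hX : IsPrefixCode X) {u v : List A} (h : u ∈ X)
    (h' : u ++ v ∈ X) : v = [] := by
  simpa using hX.2 _ h _ h' (List.prefix_append u v)

theorem IsSuffixCode.eq_nil_of_append (hX : IsSuffixCode X) {u v : List A} (h : v ∈ X)
    (h' : u ++ v ∈ X) : u = [] := by
  simpa using hX.2 _ h _ h' (List.suffix_append u v)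

/-- If p'w and p'wq are both in X then q is empty, and the link puts pw in X as well. Thus outside X
every link uses a nonempty q, which has a first letter. -/
theorem LeftConn.notMem (hX : IsPrefixCode X) {w p p' : List A} (h : LeftConn X w p p')
    (hp : p ++ w ∉ X) : p' ++ w ∉ X := by
  induction h with
  | refl => exact hp
  | tail _ hs ih =>
    obtain ⟨q, h1, h2⟩ := hs
    intro h3
    rw [← List.append_assoc] at h1 h2
    obtain rfl := hX.eq_nil_of_append h3 h2
    exact ih (by simpa using h1)

theorem LeftConn.eq_nil (hX : IsSuffixCode X) {w p : List A} (h : LeftConn X w [] p) : p = [] := by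
  induction h with
  | refl => rfl
  | tail _ hs ih =>
    obtain ⟨q, h1, h2⟩ := hs
    subst ih
    exact hX.eq_nil_of_append (by simpa using h1) h2

/-! ### Extension graphs, graphs of components and the descending induction -/

/-- The bipartite graph with edges `(a, b)` such that `a w b ∈ S`; it is the extension graph of `w`
up to isolated vertices. -/
def extGraph (S : Set (List A)) (w : List A) : SimpleGraph (A ⊕ A) :=
  relGraph fun a b => a :: (w ++ [b]) ∈ S

theorem extGraph_isAcyclic (hS : IsAcyclicSet S) (w : List A) : (extGraph S w).IsAcyclic := by
  apply SimpleGraph.isAcyclic_of_induce_nonisolated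
  have hfac := hS.1.1.2
  by_cases hw : w ∈ S
  · have hl : ∀ a b, a :: (w ++ [b]) ∈ S → a :: w ∈ S := fun a b h =>
      hfac _ _ h ⟨[], [b], by simp⟩
    have hr : ∀ a b, a :: (w ++ [b]) ∈ S → w ++ [b] ∈ S := fun a b h =>
      hfac _ _ h ⟨[a], [], by simp⟩
    have hl' : ∀ a, (∃ y, (extGraph S w).Adj (Sum.inl a) y) → a ∈ leftExt S w := by
      rintro a ⟨b | b, hb⟩ <;> simp [extGraph] at hb
      exact hl _ _ hb
    have hr' : ∀ a, (∃ y, (extGraph S w).Adj (Sum.inr a) y) → a ∈ rightExt S w := by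
      rintro a ⟨b | b, hb⟩ <;> simp [extGraph] at hb
      exact hr _ _ hb
    let f : {x | ∃ y, (extGraph S w).Adj x y} → leftExt S w ⊕ rightExt S w := fun x =>
      match x with
      | ⟨Sum.inl a, h⟩ => Sum.inl ⟨a, hl' a h⟩
      | ⟨Sum.inr a, h⟩ => Sum.inr ⟨a, hr' a h⟩
    refine (hS.2 w hw).comap ⟨f, ?_⟩ ?_
    · rintro ⟨a | a, ha⟩ ⟨b | b, hb⟩ <;> simp [extGraph, extensionGraph, f]
      exacts [fun h => ⟨hl _ _ h, hr _ _ h, h⟩, fun h => ⟨hl _ _ h, hr _ _ h, h⟩]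
    · rintro ⟨a | a, ha⟩ ⟨b | b, hb⟩ <;> simp [f]
  -- If w ∉ S there are no edges, since S is closed under factors.
  · have : (extGraph S w) = ⊥ := by
      ext x y
      rcases x with a | a <;> rcases y with b | b <;> simp [extGraph]
      · exact fun h => hw (hfac _ _ h ⟨[a], [b], by simp⟩)
      · exact fun h => hw (hfac _ _ h ⟨[b], [a], by simp⟩)
    rw [this]
    intro v c hc
    obtain ⟨y, -, hy⟩ := SimpleGraph.adj_of_mem_walk_support c hc.not_nil c.start_mem_support
    simp at hy

/-- The graph of the connected components on both sides of `w`: the vertices on the left are the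
components on the left of a word `a w`, those on the right are the components on the right of
a word `w b`, and every word of `X` of the form `u a w b v` gives an edge. -/
def componentGraph (X : Set (List A)) (w : List A) :
    SimpleGraph ((A × Set (List A)) ⊕ (A × Set (List A))) :=
  relGraph fun x y => ∃ u v, u ++ x.1 :: (w ++ y.1 :: v) ∈ X ∧
    x.2 = {u' | LeftConn X (x.1 :: w) u u'} ∧ y.2 = {v' | RightConn X (w ++ [y.1]) v v'}

/-- A connection on the left of `w` between words of `S` followed by a common letter `b` can be
realised on the left of `w b`. -/
def LeftDeterministic (S X : Set (List A)) (w : List A) : Prop :=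
  ∀ p p' b, p ++ (w ++ [b]) ∈ S → p' ++ (w ++ [b]) ∈ S → p ++ w ∉ X → LeftConn X w p p' →
    LeftConn X (w ++ [b]) p p'

def RightDeterministic (S X : Set (List A)) (w : List A) : Prop :=
  ∀ q q' a, a :: (w ++ q) ∈ S → a :: (w ++ q') ∈ S → w ++ q ∉ X → RightConn X w q q' →
    RightConn X (a :: w) q q'

/-- The letters of the vertices of the graph of components. -/
def componentGraphHom (hX : X ⊆ S) (hfac : ∀ u v : List A, v ∈ S → u <:+: v → u ∈ S)
    (w : List A) : componentGraph X w →g extGraph S w where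
  toFun := Sum.map Prod.fst Prod.fst
  map_rel' := by
    have key : ∀ u v a b, u ++ a :: (w ++ b :: v) ∈ X → a :: (w ++ [b]) ∈ S := fun u v a b h =>
      hfac _ _ (hX h) ⟨u, v, by simp⟩
    rintro (⟨a, C⟩ | ⟨a, C⟩) (⟨b, D⟩ | ⟨b, D⟩) <;> simp only [componentGraph, extGraph,
      Sum.map_inl, Sum.map_inr, relGraph_adj_inl_inr, relGraph_adj_inr_inl,
      relGraph_not_adj_inl_inl, relGraph_not_adj_inr_inr, imp_self]
    · rintro ⟨u, v, h, -⟩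
      exact key _ _ _ _ h
    · rintro ⟨u, v, h, -⟩
      exact key _ _ _ _ h

@[simp]
theorem componentGraphHom_inl (hX : X ⊆ S) (hfac : ∀ u v : List A, v ∈ S → u <:+: v → u ∈ S)
    (w : List A) (a : A × Set (List A)) :
    componentGraphHom hX hfac w (Sum.inl a) = Sum.inl a.1 := rfl

@[simp]
theorem componentGraphHom_inr (hX : X ⊆ S) (hfac : ∀ u v : List A, v ∈ S → u <:+: v → u ∈ S)
    (w : List A) (a : A × Set (List A)) :
    componentGraphHom hX hfac w (Sum.inr a) = Sum.inr a.1 := rfl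

/-- Two edges from one left vertex to the letter b come from words u a w b v and u' a w b v' with u,
u' connected on the left of aw. Determinism at aw connects them on the left of awb, so v and v' are
connected on the right of awb, hence of wb. The other side is symmetric. -/
theorem componentGraph_locallyInjective (hX : X ⊆ S)
    (hfac : ∀ u v : List A, v ∈ S → u <:+: v → u ∈ S) (hbif : IsBifixCode X) (w : List A)
    (hl : ∀ a, LeftDeterministic S X (a :: w)) (hr : ∀ b, RightDeterministic S X (w ++ [b])) :
    ∀ x y z, (componentGraph X w).Adj x y → (componentGraph X w).Adj x z →
      componentGraphHom hX hfac w y = componentGraphHom hX hfac w z → y = z := by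
  rintro (⟨a, C⟩ | ⟨a, C⟩) (⟨b, D⟩ | ⟨b, D⟩) (⟨c, E⟩ | ⟨c, E⟩) <;> simp only [componentGraph,
    relGraph_adj_inl_inr,
    relGraph_adj_inr_inl, relGraph_not_adj_inl_inl, relGraph_not_adj_inr_inr, false_imp_iff,
    imp_true_iff, Sum.inr.injEq, Sum.inl.injEq, Prod.mk.injEq]
  · rintro ⟨u, v, h, hC, hD⟩ ⟨u', v', h', hC', hE⟩ hbc
    obtain rfl : b = c := Sum.inr.inj hbc
    refine ⟨rfl, ?_⟩
    rw [hD, hE, setOf_rightConn_eq_iff]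
    have h1 : LeftConn X (a :: w) u u' := setOf_leftConn_eq_iff.1 (hC.symm.trans hC')
    have h2 := hl a u u' b (hfac _ _ (hX h) ⟨[], v, by simp⟩) (hfac _ _ (hX h') ⟨[], v', by simp⟩)
      (fun hn => by
        have := hbif.1.eq_nil_of_append hn (v := b :: v) (by simpa using h)
        simp at this) h1
    exact (h2.rightConn (v := v) (v' := v') (by simpa using h) (by simpa using h')).of_cons
  · rintro ⟨u, v, h, hD, hC⟩ ⟨u', v', h', hE, hC'⟩ hbc
    obtain rfl : b = c := Sum.inl.inj hbc
    refine ⟨rfl, ?_⟩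
    rw [hD, hE, setOf_leftConn_eq_iff]
    have h1 : RightConn X (w ++ [a]) v v' := setOf_rightConn_eq_iff.1 (hC.symm.trans hC')
    have h2 := hr a v v' b (hfac _ _ (hX h) ⟨u, [], by simp⟩) (hfac _ _ (hX h') ⟨u', [], by simp⟩)
      (fun hn => by
        have := hbif.2.eq_nil_of_append hn (u := u ++ [b]) (by simpa using h)
        simp at this) h1
    exact (h2.leftConn (u := u) (u' := u') (by simpa using h) (by simpa using h')).of_snoc

/-- A link through q = b v is a pair of edges meeting at the vertex of b and the component of v. The
prefix property keeps q nonempty, the suffix property keeps the left words nonempty. -/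
theorem LeftConn.exists_reachable (hbif : IsBifixCode X) {w u p : List A} {a : A}
    (h : LeftConn X w (u ++ [a]) p) (hu : u ++ a :: w ∉ X) :
    ∃ u' a', p = u' ++ [a'] ∧ u' ++ a' :: w ∉ X ∧ (componentGraph X w).Reachable
      (Sum.inl (a, {v | LeftConn X (a :: w) u v}))
      (Sum.inl (a', {v | LeftConn X (a' :: w) u' v})) := by
  induction h with
  | refl => exact ⟨u, a, rfl, hu, .rfl⟩
  | @tail p p' hpp hs ih =>
    obtain ⟨u1, a1, rfl, hu1, hreach⟩ := ih
    have hp' := LeftConn.notMem hbif.1 (Relation.ReflTransGen.single hs) (by simpa using hu1)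
    obtain ⟨q, h1, h2⟩ := hs
    rcases List.eq_nil_or_concat p' with rfl | ⟨u2, a2, rfl⟩
    · have := hbif.2.eq_nil_of_append (by simpa using h2) h1
      simp at this
    rcases q with _ | ⟨b, v⟩
    · exact absurd (by simpa using h1) hu1
    refine ⟨u2, a2, by simp, by simpa using hp', hreach.trans ?_⟩
    have e1 : (componentGraph X w).Adj (Sum.inl (a1, {v | LeftConn X (a1 :: w) u1 v}))
        (Sum.inr (b, {v' | RightConn X (w ++ [b]) v v'})) := by
      simp only [componentGraph, relGraph_adj_inl_inr]
      exact ⟨u1, v, by simpa using h1, rfl, rfl⟩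
    have e2 : (componentGraph X w).Adj (Sum.inl (a2, {v | LeftConn X (a2 :: w) u2 v}))
        (Sum.inr (b, {v' | RightConn X (w ++ [b]) v v'})) := by
      simp only [componentGraph, relGraph_adj_inl_inr]
      exact ⟨u2, v, by simpa using h2, rfl, rfl⟩
    exact e1.reachable.trans e2.symm.reachable

theorem leftDeterministic_of_longer (hX : X ⊆ S)
    (hfac : ∀ u v : List A, v ∈ S → u <:+: v → u ∈ S) (hbif : IsBifixCode X) (w : List A)
    (hac : (extGraph S w).IsAcyclic)
    (hl : ∀ a, LeftDeterministic S X (a :: w)) (hr : ∀ b, RightDeterministic S X (w ++ [b])) :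
    LeftDeterministic S X w := by
  intro p p' b hp hp' hpX h
  have hinj := componentGraph_locallyInjective hX hfac hbif w hl hr
  rcases List.eq_nil_or_concat p with rfl | ⟨u, a, rfl⟩
  · rw [h.eq_nil hbif.2]
    exact .refl
  rw [List.concat_eq_append] at *
  have hu : u ++ a :: w ∉ X := by simpa using hpX
  obtain ⟨u', a', rfl, hu', hreach⟩ := h.exists_reachable hbif hu
  by_cases haa : a = a'
  · subst haa
    have h1 := hreach.eq_of_locallyInjective hac (componentGraphHom hX hfac w) hinj rfl
    simp only [Sum.inl.injEq, Prod.mk.injEq, true_and] at h1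
    exact (hl a u u' b (by simpa using hp) (by simpa using hp') hu
      (setOf_leftConn_eq_iff.1 h1)).snoc
  -- For a ≠ a', the unique path of the forest from a to a' passes only through b. So the connection
  -- also runs through a component vertex over b, hence through words of X having wb as a factor.
  · have hpS : a :: (w ++ [b]) ∈ S := hfac _ _ hp ⟨u, [], by simp⟩
    have hpS' : a' :: (w ++ [b]) ∈ S := hfac _ _ hp' ⟨u', [], by simp⟩
    obtain ⟨s, hs, h1, h2⟩ := hreach.exists_adj_adj_of_locallyInjective (b := Sum.inr b) hac
      (componentGraphHom hX hfac w) hinj (by simpa using haa)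
      (relGraph_adj_inl_inr.2 hpS)
      (relGraph_adj_inr_inl.2 hpS')
    rcases s with s | ⟨c, D⟩
    · simp at hs
    obtain rfl : c = b := by simpa using hs
    simp only [componentGraph, relGraph_adj_inl_inr, relGraph_adj_inr_inl] at h1 h2
    obtain ⟨u1, v1, hx1, hu1, hv1⟩ := h1
    obtain ⟨u2, v2, hx2, hu2, hv2⟩ := h2
    rw [setOf_leftConn_eq_iff] at hu1 hu2
    have hv : RightConn X (w ++ [c]) v1 v2 := setOf_rightConn_eq_iff.1 (hv1.symm.trans hv2)
    have c1 := (hl a u u1 c (by simpa using hp) (hfac _ _ (hX hx1) ⟨[], v1, by simp⟩) hu hu1).snoc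
    have c2 := (hl a' u' u2 c (by simpa using hp') (hfac _ _ (hX hx2) ⟨[], v2, by simp⟩)
      hu' hu2).snoc
    have c3 : LeftConn X (w ++ [c]) (u1 ++ [a]) (u2 ++ [a']) :=
      hv.leftConn (by simpa using hx1) (by simpa using hx2)
    exact (c1.trans c3).trans c2.symm

theorem rightConn_iff_leftConn_reverse {w q q' : List A} :
    RightConn X w q q' ↔
      LeftConn (List.reverse ⁻¹' X) w.reverse q.reverse q'.reverse := by
  constructor
  · intro h
    refine Relation.ReflTransGen.lift List.reverse ?_ _ _ h
    rintro x y ⟨p, h1, h2⟩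
    exact ⟨p.reverse, by simpa using h1, by simpa using h2⟩
  · intro h
    rw [← List.reverse_reverse q, ← List.reverse_reverse q']
    refine Relation.ReflTransGen.lift List.reverse ?_ _ _ h
    rintro x y ⟨p, h1, h2⟩
    exact ⟨p.reverse, by simpa using h1, by simpa using h2⟩

theorem rightDeterministic_iff_reverse {w : List A} :
    RightDeterministic S X w ↔
      LeftDeterministic (List.reverse ⁻¹' S) (List.reverse ⁻¹' X) w.reverse := by
  constructor
  · intro h p p' b hp hp' hpX hc
    have := h p.reverse p'.reverse b (by simpa using hp) (by simpa using hp') (by simpa using hpX)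
      (rightConn_iff_leftConn_reverse.2 (by simpa using hc))
    simpa using rightConn_iff_leftConn_reverse.1 this
  · intro h q q' a hp hp' hpX hc
    have := h q.reverse q'.reverse a (by simpa using hp) (by simpa using hp') (by simpa using hpX)
      (rightConn_iff_leftConn_reverse.1 hc)
    exact rightConn_iff_leftConn_reverse.2 (by simpa using this)

theorem leftDeterministic_iff_reverse {w : List A} :
    LeftDeterministic S X w ↔
      RightDeterministic (List.reverse ⁻¹' S) (List.reverse ⁻¹' X) w.reverse := by
  rw [rightDeterministic_iff_reverse]
  simp [Set.preimage_preimage]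

theorem IsBifixCode.reverse (h : IsBifixCode X) : IsBifixCode (List.reverse ⁻¹' X) := by
  refine ⟨⟨fun x hx hn => h.1.1 _ hx (by simp [hn]), fun x hx y hy hxy => ?_⟩,
    ⟨fun x hx hn => h.1.1 _ hx (by simp [hn]), fun x hx y hy hxy => ?_⟩⟩
  · exact List.reverse_injective (h.2.2 _ hx _ hy (List.reverse_suffix.2 hxy))
  · exact List.reverse_injective (h.1.2 _ hx _ hy (List.reverse_prefix.2 hxy))

theorem rightDeterministic_of_longer (hX : X ⊆ S)
    (hfac : ∀ u v : List A, v ∈ S → u <:+: v → u ∈ S) (hbif : IsBifixCode X) (w : List A)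
    (hac : (extGraph S w).IsAcyclic)
    (hl : ∀ a, LeftDeterministic S X (a :: w)) (hr : ∀ b, RightDeterministic S X (w ++ [b])) :
    RightDeterministic S X w := by
  rw [rightDeterministic_iff_reverse]
  refine leftDeterministic_of_longer (S := List.reverse ⁻¹' S) (X := List.reverse ⁻¹' X)
    (fun x hx => hX hx)
    (fun u v hv huv => hfac _ _ (show v.reverse ∈ S from hv) (List.reverse_infix.2 huv)) hbif.reverse _ ?_ ?_ ?_
  · convert relGraph_swap_isAcyclic hac using 1
    simp [extGraph]
  · intro a
    simpa using rightDeterministic_iff_reverse.1 (hr a)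
  · intro b
    simpa using leftDeterministic_iff_reverse.1 (hl b)

/-- Descending induction on the length of w: once w is longer than every word of X there are no
links, which is where finiteness of X enters. -/
theorem leftDeterministic_and_rightDeterministic (hS : IsAcyclicSet S) (hX : X ⊆ S)
    (hfin : X.Finite) (hbif : IsBifixCode X) (w : List A) :
    LeftDeterministic S X w ∧ RightDeterministic S X w := by
  obtain ⟨N, hN⟩ : ∃ N, ∀ x ∈ X, x.length ≤ N :=
    let ⟨N, hN⟩ := (hfin.image List.length).bddAbove
    ⟨N, fun x hx => hN (Set.mem_image_of_mem _ hx)⟩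
  suffices ∀ n w, N < List.length w + n → LeftDeterministic S X w ∧ RightDeterministic S X w from
    this (N + 1) w (by omega)
  intro n
  induction n with
  | zero =>
    intro w hw
    constructor
    · intro p p' b _ _ _ h
      obtain rfl : p = p' := by
        induction h with
        | refl => rfl
        | tail _ hs ih =>
          obtain ⟨q, h1, h2⟩ := hs
          have := hN _ h1
          simp at this
          omega
      exact .refl
    · intro p p' b _ _ _ h
      obtain rfl : p = p' := by
        induction h with
        | refl => rfl
        | tail _ hs ih =>
          obtain ⟨q, h1, h2⟩ := hs
          have := hN _ h1
          simp at this
          omega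
      exact .refl
  | succ n ih =>
    intro w hw
    have hl : ∀ a, LeftDeterministic S X (a :: w) := fun a => (ih _ (by simp; omega)).1
    have hr : ∀ b, RightDeterministic S X (w ++ [b]) := fun b => (ih _ (by simp; omega)).2
    exact ⟨leftDeterministic_of_longer hX hS.1.1.2 hbif w (extGraph_isAcyclic hS w) hl hr,
      rightDeterministic_of_longer hX hS.1.1.2 hbif w (extGraph_isAcyclic hS w) hl hr⟩

end Connections

/-! ### Inverses of words and the group -/

section Inverse

variable {A : Type*} {θ : A → A}

@[simp]
theorem wordInv_nil : wordInv θ [] = [] := rfl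

@[simp]
theorem wordInv_append (u v : List A) : wordInv θ (u ++ v) = wordInv θ v ++ wordInv θ u := by
  simp [wordInv]

@[simp]
theorem wordInv_cons (a : A) (v : List A) : wordInv θ (a :: v) = wordInv θ v ++ [θ a] := by
  simp [wordInv]

theorem wordInv_wordInv (hθ : Function.Involutive θ) (w : List A) :
    wordInv θ (wordInv θ w) = w := by
  simp [wordInv, List.map_reverse, hθ.comp_self]

@[simp]
theorem wordToGroup_nil : wordToGroup θ [] = 1 := rfl

@[simp]
theorem wordToGroup_cons (a : A) (w : List A) :
    wordToGroup θ (a :: w) = PresentedGroup.of a * wordToGroup θ w := by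
  simp [wordToGroup]

@[simp]
theorem wordToGroup_append (u v : List A) :
    wordToGroup θ (u ++ v) = wordToGroup θ u * wordToGroup θ v := by
  simp [wordToGroup]

theorem of_mul_of_theta (a : A) :
    (PresentedGroup.of a * PresentedGroup.of (θ a) : SpecularGroup θ) = 1 :=
  PresentedGroup.one_of_mem (Set.mem_range_self a)

theorem wordToGroup_wordInv (w : List A) :
    wordToGroup θ (wordInv θ w) = (wordToGroup θ w)⁻¹ := by
  induction w with
  | nil => simp
  | cons a w ih =>
    have h := inv_eq_of_mul_eq_one_right (of_mul_of_theta (θ := θ) a)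
    simp [ih, h]

/-- The elements of the subgroup generated by a symmetric set of words are represented by the
concatenations of these words. -/
theorem exists_wordToGroup_eq_of_mem_subgroupGenerated {X : Set (List A)}
    (hX : IsSymmetricSet θ X) {g : SpecularGroup θ} (hg : g ∈ subgroupGenerated θ X) :
    ∃ l : List (List A), (∀ x ∈ l, x ∈ X) ∧ wordToGroup θ l.flatten = g := by
  induction hg using Subgroup.closure_induction with
  | mem g hg =>
    obtain ⟨x, hx, rfl⟩ := hg
    exact ⟨[x], by simpa using hx, by simp⟩
  | one => exact ⟨[], by simp, rfl⟩
  | mul g h _ _ ihg ihh =>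
    obtain ⟨l, hl, rfl⟩ := ihg
    obtain ⟨m, hm, rfl⟩ := ihh
    refine ⟨l ++ m, fun x hx => ?_, by simp⟩
    exact (List.mem_append.1 hx).elim (hl x) (hm x)
  | inv g _ ih =>
    obtain ⟨l, hl, rfl⟩ := ih
    refine ⟨(l.map (wordInv θ)).reverse, fun x hx => ?_, ?_⟩
    · simp only [List.mem_reverse, List.mem_map] at hx
      obtain ⟨y, hy, rfl⟩ := hx
      exact hX _ (hl y hy)
    · rw [← wordToGroup_wordInv]
      congr 1
      clear * -
      induction l with
      | nil => rfl
      | cons x l ih => simp [ih]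

end Inverse

/-! ### Uniqueness of reduced words -/

section Reduction

variable {A : Type*} {θ : A → A}

open Classical in
/-- Left multiplication of a reduced word by a letter. -/
noncomputable def consReduce (θ : A → A) (a : A) : List A → List A
  | [] => [a]
  | b :: l => if b = θ a then l else a :: b :: l

/-- The reduced word obtained from a word by deleting factors `a θ(a)`. -/
noncomputable def reduceWord (θ : A → A) (w : List A) : List A := w.foldr (consReduce θ) []

theorem IsReducedWord.of_cons {a : A} {w : List A} (h : IsReducedWord θ (a :: w)) :
    IsReducedWord θ w := fun b hb => h b (hb.trans (List.suffix_cons a w).isInfix)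

theorem IsReducedWord.ne_of_cons_cons {a b : A} {w : List A}
    (h : IsReducedWord θ (a :: b :: w)) : b ≠ θ a := by
  rintro rfl
  exact h a ⟨[], w, by simp⟩

theorem isReducedWord_nil : IsReducedWord θ [] := fun a h => by
  simpa using h.length_le

theorem IsReducedWord.cons_cons {a b : A} {w : List A} (h : IsReducedWord θ (b :: w))
    (hab : b ≠ θ a) : IsReducedWord θ (a :: b :: w) := by
  intro c hc
  rcases List.infix_cons_iff.1 hc with h' | h'
  · obtain ⟨t, ht⟩ := h'
    simp only [List.cons_append, List.cons.injEq] at ht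
    obtain ⟨rfl, rfl, -⟩ := ht
    exact hab rfl
  · exact h c h'

theorem IsReducedWord.isReducedWord_consReduce {w : List A} (h : IsReducedWord θ w) (a : A) :
    IsReducedWord θ (consReduce θ a w) := by
  rcases w with _ | ⟨b, w⟩
  · intro c hc
    simpa [consReduce] using hc.length_le
  · simp only [consReduce]
    split_ifs with hb
    · exact h.of_cons
    · exact h.cons_cons hb

theorem IsReducedWord.consReduce_of_cons {a : A} {w : List A} (h : IsReducedWord θ (a :: w)) :
    consReduce θ a w = a :: w := by
  rcases w with _ | ⟨b, w⟩
  · rfl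
  · simp [consReduce, h.ne_of_cons_cons]

theorem IsReducedWord.consReduce_consReduce (hθ : Function.Involutive θ) {w : List A}
    (h : IsReducedWord θ w) (a : A) :
    consReduce θ (θ a) (consReduce θ a w) = w := by
  rcases w with _ | ⟨b, w⟩
  · simp [consReduce, hθ a]
  · by_cases hb : b = θ a
    · subst hb
      simpa [consReduce] using h.consReduce_of_cons
    · simp [consReduce, hb, hθ a]

theorem IsReducedWord.reduceWord_eq {w : List A} (h : IsReducedWord θ w) : reduceWord θ w = w := by
  induction w with
  | nil => rfl
  | cons a w ih =>
    have : reduceWord θ (a :: w) = consReduce θ a (reduceWord θ w) := rfl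
    rw [this, ih h.of_cons, h.consReduce_of_cons]

/-- The permutation of the set of reduced words induced by a letter. -/
noncomputable def reducedPerm (hθ : Function.Involutive θ) (a : A) :
    Equiv.Perm {w : List A // IsReducedWord θ w} where
  toFun w := ⟨consReduce θ a w.1, w.2.isReducedWord_consReduce a⟩
  invFun w := ⟨consReduce θ (θ a) w.1, w.2.isReducedWord_consReduce (θ a)⟩
  left_inv w := Subtype.ext (w.2.consReduce_consReduce hθ a)
  right_inv w := Subtype.ext (by simpa [hθ a] using w.2.consReduce_consReduce hθ (θ a))

theorem reducedPerm_relation (hθ : Function.Involutive θ) :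
    ∀ r ∈ Set.range fun a : A => FreeGroup.of a * FreeGroup.of (θ a),
      FreeGroup.lift (reducedPerm hθ) r = 1 := by
  rintro _ ⟨a, rfl⟩
  ext w : 2
  simpa [reducedPerm, hθ a] using w.2.consReduce_consReduce hθ (θ a)

/-- Van der Waerden's argument: the group acts on reduced words, and a word sends the empty word to
its reduction. -/
theorem reduceWord_eq_of_wordToGroup_eq (hθ : Function.Involutive θ) {u v : List A}
    (h : wordToGroup θ u = wordToGroup θ v) : reduceWord θ u = reduceWord θ v := by
  have key : ∀ w : List A, (PresentedGroup.toGroup (reducedPerm_relation hθ) (wordToGroup θ w)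
      ⟨[], isReducedWord_nil⟩).1 = reduceWord θ w := by
    intro w
    induction w with
    | nil => simp [reduceWord]
    | cons a w ih =>
      rw [wordToGroup_cons, map_mul, PresentedGroup.toGroup.of, Equiv.Perm.mul_apply]
      change consReduce θ a _ = consReduce θ a (reduceWord θ w)
      rw [ih]
  rw [← key, ← key, h]

end Reduction

/-! ### The coset automaton -/

section Cosets

variable {A : Type*} {θ : A → A} {S X : Set (List A)}

/-- The relation generated by the pairs `(p, q)` such that `p q⁻¹` belongs to `X`. -/
def CosetRel (θ : A → A) (X : Set (List A)) : List A → List A → Prop :=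
  Relation.ReflTransGen fun p p' => p ++ wordInv θ p' ∈ X

theorem IsSymmetricSet.append_wordInv_comm (hθ : Function.Involutive θ) (hX : IsSymmetricSet θ X)
    {p p' : List A} (h : p ++ wordInv θ p' ∈ X) : p' ++ wordInv θ p ∈ X := by
  simpa [wordInv_wordInv hθ] using hX _ h

theorem CosetRel.symm (hθ : Function.Involutive θ) (hX : IsSymmetricSet θ X) {p p' : List A}
    (h : CosetRel θ X p p') : CosetRel θ X p' p :=
  haveI : Std.Symm fun p p' => p ++ wordInv θ p' ∈ X := ⟨fun _ _ h => hX.append_wordInv_comm hθ h⟩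
  Relation.ReflTransGen.stdSymm.symm _ _ h

theorem cosetRel_wordInv (hθ : Function.Involutive θ) {p q : List A} (h : p ++ q ∈ X) :
    CosetRel θ X p (wordInv θ q) :=
  .single (by rwa [wordInv_wordInv hθ])

theorem LeftConn.cosetRel (hθ : Function.Involutive θ) (hX : IsSymmetricSet θ X)
    {w p p' : List A} (h : LeftConn X w p p') : CosetRel θ X (p ++ w) (p' ++ w) := by
  induction h with
  | refl => exact .refl
  | tail _ hs ih =>
    obtain ⟨q, h1, h2⟩ := hs
    exact (ih.trans (cosetRel_wordInv hθ (q := q) (by simpa using h1))).trans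
      ((cosetRel_wordInv hθ (q := q) (by simpa using h2)).symm hθ hX)

/-- Parity of the chain: by symmetry of X, two consecutive steps form one link on the left of the
empty word. -/
theorem CosetRel.leftConn_or (hθ : Function.Involutive θ) (hX : IsSymmetricSet θ X)
    {p p' : List A} (h : CosetRel θ X p p') :
    LeftConn X [] p p' ∨ ∃ p₂, LeftConn X [] p p₂ ∧ p₂ ++ wordInv θ p' ∈ X := by
  induction h with
  | refl => exact .inl .refl
  | tail _ hs ih =>
    rcases ih with h | ⟨p₂, h, h₂⟩
    · exact .inr ⟨_, h, hs⟩
    · exact .inl (h.tail ⟨_, h₂, hX.append_wordInv_comm hθ hs⟩)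

theorem CosetRel.eq_nil (hθ : Function.Involutive θ) (hX : IsSymmetricSet θ X)
    (hbif : IsBifixCode X) {p : List A} (h : CosetRel θ X p []) (hp : p ∉ X) : p = [] := by
  rcases h.leftConn_or hθ hX with h | ⟨p₂, h, h₂⟩
  · exact h.symm.eq_nil hbif.2
  · exact absurd (by simpa using h₂) (h.notMem hbif.1 (by simpa using hp))

/-- Inversion sends a on one side to θ(a) on the other. It fixes no vertex because it swaps sides,
and flips no edge because a θ(a) is not reduced. -/
theorem extGraph_nil_not_reachable (hθ : Function.Involutive θ) (hlam : IsLaminary θ S)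
    (hS : IsAcyclicSet S) (b : A) :
    ¬ (extGraph S []).Reachable (Sum.inr b) (Sum.inl (θ b)) := by
  have hsym : ∀ a b, [a, b] ∈ S → [θ b, θ a] ∈ S := fun a b h => by
    simpa using hlam.1 _ h
  let σ : extGraph S [] →g extGraph S [] :=
    { toFun := Sum.elim (fun a => Sum.inr (θ a)) (fun a => Sum.inl (θ a))
      map_rel' := by
        rintro (a | a) (b | b) <;> simp [extGraph] <;> exact hsym _ _ }
  refine (extGraph_isAcyclic hS []).not_reachable_involutive σ ?_ ?_ ?_ (Sum.inr b)
  · rintro (a | a) <;> simp [σ, hθ a]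
  · rintro (a | a) <;> simp [σ]
  · rintro (a | a) h
    · have h' : [a, θ a] ∈ S :=
        (relGraph_adj_inl_inr (r := fun a b => a :: ([] ++ [b]) ∈ S)).1 h
      exact hlam.2.2 _ h' a List.infix_rfl
    · have h' : [θ a, a] ∈ S :=
        (relGraph_adj_inr_inl (r := fun a b => a :: ([] ++ [b]) ∈ S)).1 h
      exact hlam.2.2 _ h' (θ a) (by simp [hθ a])

theorem LeftConn.extGraph_reachable (hX : X ⊆ S)
    (hfac : ∀ u v : List A, v ∈ S → u <:+: v → u ∈ S) (hbif : IsBifixCode X) {w u p : List A}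
    {a : A} (h : LeftConn X w (u ++ [a]) p) (hu : u ++ a :: w ∉ X) :
    ∃ u' a', p = u' ++ [a'] ∧ (extGraph S w).Reachable (Sum.inl a) (Sum.inl a') := by
  obtain ⟨u', a', hp, -, hr⟩ := h.exists_reachable hbif hu
  exact ⟨u', a', hp, hr.map (componentGraphHom hX hfac w)⟩

/-- An even chain is handled by determinism at the empty word. An odd chain would join b on the
right to θ(b) on the left in the extension graph of the empty word: b to the last letter of p, along
the chain, then to θ(a') and θ(b), where a' is the last letter of p'. -/
theorem CosetRel.leftConn_singleton (hθ : Function.Involutive θ) (hlam : IsLaminary θ S)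
    (hS : IsAcyclicSet S) (hXS : X ⊆ S) (hfin : X.Finite) (hbif : IsBifixCode X)
    (hX : IsSymmetricSet θ X) {p p' : List A} {b : A} (h : CosetRel θ X p p')
    (hp : p ∉ X) (hp' : p' ∉ X) (hpb : p ++ [b] ∈ S) (hpb' : p' ++ [b] ∈ S) :
    LeftConn X [b] p p' := by
  have hfac := hS.1.1.2
  rcases h.leftConn_or hθ hX with hc | ⟨p₂, hc, h₂⟩
  · exact (leftDeterministic_and_rightDeterministic hS hXS hfin hbif []).1 p p' b
      (by simpa using hpb) (by simpa using hpb') (by simpa using hp) hc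
  exfalso
  rcases List.eq_nil_or_concat p with rfl | ⟨u, a, rfl⟩
  · obtain rfl := hc.eq_nil hbif.2
    exact hp' (by simpa [wordInv_wordInv hθ] using hX _ h₂)
  rw [List.concat_eq_append] at *
  rcases List.eq_nil_or_concat p' with rfl | ⟨u', a', rfl⟩
  · exact hc.notMem hbif.1 (by simpa using hp) (by simpa using h₂)
  rw [List.concat_eq_append] at *
  obtain ⟨u₂, a₂, rfl, hr⟩ := hc.extGraph_reachable hXS hfac hbif (by simpa using hp)
  refine extGraph_nil_not_reachable hθ hlam hS b ?_
  have e1 : (extGraph S []).Adj (Sum.inr b) (Sum.inl a) :=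
    relGraph_adj_inr_inl.2 (hfac _ _ hpb ⟨u, [], by simp⟩)
  have e2 : (extGraph S []).Adj (Sum.inl a₂) (Sum.inr (θ a')) :=
    relGraph_adj_inl_inr.2 (hfac _ _ (hXS h₂) ⟨u₂, wordInv θ u', by simp⟩)
  have e3 : (extGraph S []).Adj (Sum.inr (θ a')) (Sum.inl (θ b)) :=
    relGraph_adj_inr_inl.2 (hfac _ _ (hlam.1 _ hpb') ⟨[], wordInv θ u', by simp⟩)
  exact ((e1.reachable.trans hr).trans e2.reachable).trans e3.reachable

/-- The transition by the letter `a` in the automaton whose states are the classes of the relation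
`CosetRel`. -/
def CosetStep (θ : A → A) (X : Set (List A)) (a : A) (p r : List A) : Prop :=
  ∃ p' s, CosetRel θ X p p' ∧ p' ++ a :: s ∈ X ∧ CosetRel θ X (p' ++ [a]) r

/-- The word `w` is the label of a path from `p` to `r` in the automaton whose states are the
classes of the relation `CosetRel`. -/
def CosetPath (θ : A → A) (X : Set (List A)) : List A → List A → List A → Prop
  | [], p, r => CosetRel θ X p r
  | a :: w, p, r => ∃ t, CosetStep θ X a p t ∧ CosetPath θ X w t r

theorem CosetPath.of_rel {w p p' r : List A} (h : CosetRel θ X p p') (h' : CosetPath θ X w p' r) :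
    CosetPath θ X w p r := by
  cases w with
  | nil => exact h.trans h'
  | cons a w =>
    obtain ⟨t, ⟨q, s, h1, h2⟩, ht⟩ := h'
    exact ⟨t, ⟨q, s, h.trans h1, h2⟩, ht⟩

theorem CosetPath.append {v w p r t : List A} (h : CosetPath θ X v p r)
    (h' : CosetPath θ X w r t) : CosetPath θ X (v ++ w) p t := by
  induction v generalizing p with
  | nil => exact h'.of_rel h
  | cons a v ih =>
    obtain ⟨q, h1, h2⟩ := h
    exact ⟨q, h1, ih h2⟩

theorem cosetPath_of_mem {x : List A} (hx : x ∈ X) : CosetPath θ X x [] [] := by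
  suffices ∀ v u, u ++ v ∈ X → CosetPath θ X v u [] from this x [] hx
  intro v
  induction v with
  | nil => exact fun u hu => .single (by simpa using hu)
  | cons a v ih =>
    intro u hu
    exact ⟨u ++ [a], ⟨u, v, .refl, hu, .refl⟩, ih _ (by simpa using hu)⟩

theorem cosetPath_flatten {l : List (List A)} (hl : ∀ x ∈ l, x ∈ X) :
    CosetPath θ X l.flatten [] [] := by
  induction l with
  | nil => exact .refl
  | cons x l ih =>
    exact (cosetPath_of_mem (hl x (by simp))).append (ih fun y hy => hl y (by simp [hy]))

/-- The inverse of p' a s is s⁻¹ θ(a) p'⁻¹, where s⁻¹ is in the state of p' a. -/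
theorem CosetStep.inv (hθ : Function.Involutive θ) (hX : IsSymmetricSet θ X) {a : A}
    {p r : List A} (h : CosetStep θ X a p r) : CosetStep θ X (θ a) r p := by
  obtain ⟨p', s, h1, h2, h3⟩ := h
  have h4 : wordInv θ s ++ θ a :: wordInv θ p' ∈ X := by simpa using hX _ h2
  refine ⟨wordInv θ s, wordInv θ p', ?_, h4, ?_⟩
  · exact (h3.symm hθ hX).trans (cosetRel_wordInv hθ (by simpa using h2))
  · have : CosetRel θ X (wordInv θ s ++ [θ a]) p' := .single (by simpa using h4)
    exact this.trans (h1.symm hθ hX)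

theorem IsPrefixCode.notMem_of_append_cons (hX : IsPrefixCode X) {p s : List A} {a : A}
    (h : p ++ a :: s ∈ X) : p ∉ X := fun hp => by
  simpa using hX.eq_nil_of_append hp h

theorem CosetStep.rel (hθ : Function.Involutive θ) (hlam : IsLaminary θ S)
    (hS : IsAcyclicSet S) (hXS : X ⊆ S) (hfin : X.Finite) (hbif : IsBifixCode X)
    (hX : IsSymmetricSet θ X) {a : A} {p q r t : List A} (h : CosetStep θ X a p r)
    (h' : CosetStep θ X a q t) (hpq : CosetRel θ X p q) : CosetRel θ X r t := by
  have hfac := hS.1.1.2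
  obtain ⟨p', s, h1, h2, h3⟩ := h
  obtain ⟨q', s', h1', h2', h3'⟩ := h'
  have h4 : LeftConn X [a] p' q' := by
    refine CosetRel.leftConn_singleton hθ hlam hS hXS hfin hbif hX
      (((h1.symm hθ hX).trans hpq).trans h1') (hbif.1.notMem_of_append_cons h2)
      (hbif.1.notMem_of_append_cons h2') (hfac _ _ (hXS h2) ⟨[], s, by simp⟩)
      (hfac _ _ (hXS h2') ⟨[], s', by simp⟩)
  exact ((h3.symm hθ hX).trans (h4.cosetRel hθ hX)).trans h3'

/-- A step by a followed by one by θ(a) ends where it began: the first step reversed is also a step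
by θ(a), and steps are deterministic. -/
theorem CosetPath.reduce (hθ : Function.Involutive θ) (hlam : IsLaminary θ S)
    (hS : IsAcyclicSet S) (hXS : X ⊆ S) (hfin : X.Finite) (hbif : IsBifixCode X)
    (hX : IsSymmetricSet θ X) {w p r : List A} (h : CosetPath θ X w p r) :
    CosetPath θ X (reduceWord θ w) p r := by
  induction w generalizing p with
  | nil => exact h
  | cons a w ih =>
    obtain ⟨t, h1, h2⟩ := h
    have h3 := ih h2
    change CosetPath θ X (consReduce θ a (reduceWord θ w)) p r
    rcases hw : reduceWord θ w with _ | ⟨b, v⟩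
    · rw [hw] at h3
      exact ⟨t, h1, h3⟩
    · rw [hw] at h3
      simp only [consReduce]
      split_ifs with hb
      · subst hb
        obtain ⟨q, h4, h5⟩ := h3
        exact h5.of_rel ((h1.inv hθ hX).rel hθ hlam hS hXS hfin hbif hX h4 .refl)
      · exact ⟨t, h1, h3⟩

theorem nil_mem_wordStar : [] ∈ wordStar X := ⟨[], by simp, rfl⟩

theorem append_mem_wordStar {x w : List A} (hx : x ∈ X) (hw : w ∈ wordStar X) :
    x ++ w ∈ wordStar X := by
  obtain ⟨l, hl, rfl⟩ := hw
  exact ⟨x :: l, by simpa using ⟨hx, hl⟩, rfl⟩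

/-- The prefix p actually read represents the current state, because it stays connected to the words
of X defining the transitions. -/
theorem CosetPath.mem_wordStar (hθ : Function.Involutive θ) (hlam : IsLaminary θ S)
    (hS : IsAcyclicSet S) (hXS : X ⊆ S) (hfin : X.Finite) (hbif : IsBifixCode X)
    (hX : IsSymmetricSet θ X) {w p : List A} (hp : p ∉ X) (hpw : p ++ w ∈ S)
    (h : CosetPath θ X w p []) : p ++ w ∈ wordStar X := by
  have hfac := hS.1.1.2
  induction w generalizing p with
  | nil =>
    rw [CosetRel.eq_nil hθ hX hbif h hp]
    exact nil_mem_wordStar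
  | cons a w ih =>
    obtain ⟨t, ⟨p', s, h1, h2, h3⟩, ht⟩ := h
    have h4 : LeftConn X [a] p p' :=
      h1.leftConn_singleton hθ hlam hS hXS hfin hbif hX hp (hbif.1.notMem_of_append_cons h2)
        (hfac _ _ hpw ⟨[], w, by simp⟩) (hfac _ _ (hXS h2) ⟨[], s, by simp⟩)
    have h5 : CosetPath θ X w (p ++ [a]) [] := ht.of_rel ((h4.cosetRel hθ hX).trans h3)
    -- When the prefix enters X, it is in the state of the empty word: that factor is split off and
    -- reading restarts.
    by_cases hpa : p ++ [a] ∈ X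
    · have h6 : CosetRel θ X [] (p ++ [a]) :=
        CosetRel.symm hθ hX (.single (by simpa using hpa))
      have h7 := ih (p := []) (fun hn => hbif.1.1 _ hn rfl)
        (hfac _ _ hpw ⟨p ++ [a], [], by simp⟩) (h5.of_rel h6)
      simpa using append_mem_wordStar hpa h7
    · simpa using ih hpa (by simpa using hpw) h5

theorem wordToGroup_mem_of_mem_wordStar {w : List A} (hw : w ∈ wordStar X) :
    wordToGroup θ w ∈ subgroupGenerated θ X := by
  obtain ⟨l, hl, rfl⟩ := hw
  induction l with
  | nil => exact one_mem _
  | cons x l ih =>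
    rw [List.flatten_cons, wordToGroup_append]
    exact mul_mem (Subgroup.subset_closure ⟨x, hl x (by simp), rfl⟩)
      (ih fun y hy => hl y (by simp [hy]))

theorem exists_prefix_of_mem_wordStar {w : List A} (hw : w ∈ wordStar X) (hne : w ≠ []) :
    ∃ x ∈ X, x <+: w := by
  obtain ⟨l, hl, rfl⟩ := hw
  cases l with
  | nil => exact absurd rfl hne
  | cons x l => exact ⟨x, hl x (by simp), by simp⟩

theorem interWords_subgroupGenerated_eq (hθ : Function.Involutive θ) (hlam : IsLaminary θ S)
    (hS : IsAcyclicSet S) (hXS : X ⊆ S) (hfin : X.Finite) (hbif : IsBifixCode X)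
    (hX : IsSymmetricSet θ X) :
    interWords θ (subgroupGenerated θ X) S = wordStar X ∩ S := by
  ext w
  constructor
  · rintro ⟨hwS, hw⟩
    obtain ⟨l, hl, hlw⟩ := exists_wordToGroup_eq_of_mem_subgroupGenerated hX hw
    have h := (cosetPath_flatten (θ := θ) hl).reduce hθ hlam hS hXS hfin hbif hX
    rw [reduceWord_eq_of_wordToGroup_eq hθ hlw, (hlam.2.2 w hwS).reduceWord_eq] at h
    exact ⟨CosetPath.mem_wordStar hθ hlam hS hXS hfin hbif hX (p := [])
      (fun hn => hbif.1.1 _ hn rfl) hwS h, hwS⟩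
  · rintro ⟨hw, hwS⟩
    exact ⟨hwS, wordToGroup_mem_of_mem_wordStar hw⟩

end Cosets

theorem mainTheorem4 {A : Type*} [Finite A] (θ : A → A) (hθ : Function.Involutive θ)
    (S : Set (List A)) (hSlam : IsLaminary θ S) (hSacyc : IsAcyclicSet S)
    (X : Set (List A)) (hXS : X ⊆ S) (hXfin : X.Finite) (hXbifix : IsBifixCode X)
    (hXsymm : IsSymmetricSet θ X) :
    X = primeWords θ (subgroupGenerated θ X) S ∧
      interWords θ (subgroupGenerated θ X) S = wordStar X ∩ S := by
  have hinter := interWords_subgroupGenerated_eq hθ hSlam hSacyc hXS hXfin hXbifix hXsymm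
  refine ⟨?_, hinter⟩
  have hstar : ∀ x ∈ X, x ∈ wordStar X := fun x hx => ⟨[x], by simpa using hx, by simp⟩
  unfold primeWords
  rw [hinter]
  ext w
  constructor
  · intro hw
    refine ⟨⟨hstar w hw, hXS hw⟩, hXbifix.1.1 w hw, ?_⟩
    rintro p hpw hp hne ⟨hps, -⟩
    obtain ⟨x, hx, hxp⟩ := exists_prefix_of_mem_wordStar hps hp
    obtain rfl := hXbifix.1.2 x hx w hw (hxp.trans hpw)
    exact hne (hpw.eq_of_length_le hxp.length_le)
  · rintro ⟨⟨hw, hwS⟩, hne, hprime⟩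
    obtain ⟨x, hx, hxw⟩ := exists_prefix_of_mem_wordStar hw hne
    by_cases hxe : x = w
    · exact hxe ▸ hx
    · exact absurd ⟨hstar x hx, hXS hx⟩ (hprime x hxw (hXbifix.1.1 x hx) hxe)
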